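/- For a subset \(A\) of a topological space let \(bA\), \(iA\) and \(fA\) denote its closure, interior and boundary (\(fA=bA\cap b(X\setminus A)\), where \(X\) is the whole space), let \(0A=\varnothing\) and \(\mathrm{id}A=A\), and write products of operators for compositions (the rightmost factor acts first). Let \(KF^0=K^0\cup F^0\) be the set of the seventeen operators \[K^0=\{\mathrm{id},\,b,\,i,\,bi,\,ib,\,bib,\,ibi\},\qquad F^0=\{0,\,f,\,if,\,fif,\,bif,\,ff,\,fb,\,fi,\,fbi,\,fib\}.\] A *local ordering* of \(KF^0\) is a set \(P\) of ordered pairs of these operator symbols for which there exist a topological space \(X\) and a subset \(A\subseteq X\) such that, for all \(o_1,o_2\in KF^0\), \((o_1,o_2)\in P\) if and only if \(o_1A\subseteq o_2A\). **Proposition.** \(KF^0\) has exactly \(274\) local orderings. -/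

import Mathlib

universe u

/-- The seventeen operator symbols of `KF⁰ = K⁰ ∪ F⁰`, written as words in closure `b`,
interior `i` and boundary `f`, the rightmost letter acting first.
The symbol `i_f` stands for the word `if`, `id` is the identity operator and `zero` the zero operator `A ↦ ∅`.
The symbols of `K⁰` are `id, b, i, bi, ib, bib, ibi`, the other ten are those of `F⁰`. -/
inductive KF0 : Type
  | id | b | i | bi | ib | bib | ibi
  | zero | f | i_f | fif | bif | ff | fb | fi | fbi | fib
  deriving DecidableEq

instance KF0.instFintype : Fintype KF0 where
  elems := {.id, .b, .i, .bi, .ib, .bib, .ibi,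
    .zero, .f, .i_f, .fif, .bif, .ff, .fb, .fi, .fbi, .fib}
  complete := by intro o; cases o <;> decide

/-- The set `oA` obtained by applying the operator `o ∈ KF⁰` to a subset `A` of a topological
space. -/
def KF0.apply {X : Type*} [TopologicalSpace X] : KF0 → Set X → Set X
  | .id, A => A
  | .b, A => closure A
  | .i, A => interior A
  | .bi, A => closure (interior A)
  | .ib, A => interior (closure A)
  | .bib, A => closure (interior (closure A))
  | .ibi, A => interior (closure (interior A))
  | .zero, _ => ∅
  | .f, A => frontier A
  | .i_f, A => interior (frontier A)
  | .fif, A => frontier (interior (frontier A))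
  | .bif, A => closure (interior (frontier A))
  | .ff, A => frontier (frontier A)
  | .fb, A => frontier (closure A)
  | .fi, A => frontier (interior A)
  | .fbi, A => frontier (closure (interior A))
  | .fib, A => frontier (interior (closure A))

/-- The subset `A` satisfies the ordering `P` on `KF⁰`: for all `o₁, o₂ ∈ KF⁰`, the pair
`(o₁, o₂)` belongs to `P` if and only if `o₁A ⊆ o₂A`. -/
def KF0.Satisfies {X : Type*} [TopologicalSpace X] (A : Set X) (P : Set (KF0 × KF0)) : Prop :=
  ∀ o₁ o₂ : KF0, o₁.apply A ⊆ o₂.apply A ↔ (o₁, o₂) ∈ P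

/-- `P` is a local ordering of `KF⁰`: some subset of some topological space satisfies it.
(Such a `P` is reflexive and transitive; it is a partial order once symbols `o₁, o₂` with
`o₁A = o₂A` are identified.) -/
def KF0.IsLocalOrdering (P : Set (KF0 × KF0)) : Prop :=
  ∃ (X : Type u) (_ : TopologicalSpace X) (A : Set X), KF0.Satisfies A P

/-! ### Point types

The membership of a point `x` in the sets `oA`, `o ∈ KF⁰`, follows one of sixteen patterns. -/

/-! Inclusions among the sets `oA` depend only on which membership patterns occur among the points.
Seven memberships determine a pattern, and the relations between the operators leave sixteen
patterns. Some patterns force others to occur, which preorders them: the types occurring for a given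
`A` form an upper set (`HasType.exists_of_le`). Conversely, the sixteen types with the upper-set
topology form a space in which each type has itself as type (`hasType_self`), and its open subspaces
realise every upper set. So local orderings are exactly the sets `ordering T` for upper sets `T`
(`isLocalOrdering_iff`). Different upper sets can give the same ordering, so orderings themselves
are counted. As `ordering` turns unions into intersections, the failing inclusions of principal
upper sets are stored as bit masks, and the distinct bitwise unions of the sixteen masks are
counted. -/

/-- The patterns of membership of a point in the seventeen sets `oA`. Where two types have the same
name up to a suffix, `In` and `Out` tell whether the point belongs to `A`.
`core` is the interior of `A`, `ext` the exterior, `shell` is `ibi ∖ i`, `scr` is `if`,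
`mix` is `(ib ∩ bi) ∖ ibi`, and the other types lie outside `ib`:
`wild` is `bi ∩ bif`, `rim` is `bi ∖ bif`, `fringe` is `bif ∖ bi` and `sparse` is `b ∖ bib`. -/
inductive PointType : Type
  | core | shellOut | shellIn | scrOut | scrIn | mixOut | mixIn | wildOut | wildIn
  | rimOut | rimIn | fringeOut | fringeIn | sparseOut | sparseIn | ext
  deriving DecidableEq

namespace PointType

instance instFintype : Fintype PointType where
  elems := {core, shellOut, shellIn, scrOut, scrIn, mixOut, mixIn, wildOut, wildIn,
    rimOut, rimIn, fringeOut, fringeIn, sparseOut, sparseIn, ext}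
  complete := by intro t; cases t <;> decide

/-- Membership in `A` of a point of the given type. -/
def inId : PointType → Bool
  | core | shellIn | scrIn | mixIn | wildIn | rimIn | fringeIn | sparseIn => true
  | _ => false

/-- Membership in `bA` of a point of the given type. -/
def inB : PointType → Bool
  | ext => false
  | _ => true

/-- Membership in `iA` of a point of the given type. -/
def inI : PointType → Bool
  | core => true
  | _ => false

/-- Membership in `biA` of a point of the given type. -/
def inBi : PointType → Bool
  | core | shellOut | shellIn | mixOut | mixIn | wildOut | wildIn | rimOut | rimIn => true
  | _ => false

/-- Membership in `ibA` of a point of the given type. -/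
def inIb : PointType → Bool
  | core | shellOut | shellIn | scrOut | scrIn | mixOut | mixIn => true
  | _ => false

/-- Membership in `ibiA` of a point of the given type. -/
def inIbi : PointType → Bool
  | core | shellOut | shellIn => true
  | _ => false

/-- Membership in `bifA` of a point of the given type. -/
def inBif : PointType → Bool
  | scrOut | scrIn | mixOut | mixIn | wildOut | wildIn | fringeOut | fringeIn => true
  | _ => false

/-- Membership in `oA` of a point of the given type. -/
def mem (t : PointType) : KF0 → Bool
  | .id => t.inId
  | .b => t.inB
  | .i => t.inI
  | .bi => t.inBi
  | .ib => t.inIb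
  | .bib => t.inBi || t.inBif
  | .ibi => t.inIbi
  | .zero => false
  | .f => t.inB && !t.inI
  | .i_f => t.inIb && !t.inBi
  | .fif => t.inBif && !(t.inIb && !t.inBi)
  | .bif => t.inBif
  | .ff => t.inB && !t.inI && !(t.inIb && !t.inBi)
  | .fb => t.inB && !t.inIb
  | .fi => t.inBi && !t.inI
  | .fbi => t.inBi && !t.inIbi
  | .fib => (t.inBi || t.inBif) && !t.inIb

/-- `t.leB s` holds if a point of type `t` forces points of type `s` in each of its
neighbourhoods. -/
def leB (t s : PointType) : Bool :=
  decide (t = s) || match s with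
    | core => t.inBi
    | ext => t.inB && !t.inIb
    | scrOut | scrIn => t.inBif
    | shellOut => decide (t = shellIn)
    | sparseIn => decide (t = sparseOut)
    | _ => false

instance instPreorder : Preorder PointType where
  le t s := t.leB s = true
  le_refl t := by simp [leB]
  le_trans := by
    have h : ∀ r s t : PointType, r.leB s = true → s.leB t = true → r.leB t = true := by
      decide +kernel
    exact h

instance instDecidableLE : DecidableLE PointType :=
  fun t s => inferInstanceAs (Decidable (t.leB s = true))

end PointType

/-! ### Counting -/

namespace PointType

/-- The list of all operators, used to number the pairs of operators. -/
def ops : Fin 17 → KF0 :=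
  ![.id, .b, .i, .bi, .ib, .bib, .ibi, .zero, .f, .i_f, .fif, .bif, .ff, .fb, .fi, .fbi, .fib]

/-- The pair of operators with number `k`. -/
def opPair (k : Fin (17 * 17)) : KF0 × KF0 := (ops k.divNat, ops k.modNat)

/-- All point types. -/
def all : List PointType :=
  [core, shellOut, shellIn, scrOut, scrIn, mixOut, mixIn, wildOut, wildIn,
    rimOut, rimIn, fringeOut, fringeIn, sparseOut, sparseIn, ext]

/-- Whether some type above `t` separates the first operator of a pair from the second. -/
def violates (t : PointType) (p : KF0 × KF0) : Bool :=
  all.any fun s => t.leB s && s.mem p.1 && !s.mem p.2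

/-- The binary encoding of the pairs violated by `t`. -/
def mask (t : PointType) : ℕ := Nat.ofBits fun k => t.violates (opPair k)

/-- The bitwise unions of the numbers in a list. -/
def joins : List ℕ → List ℕ
  | [] => [0]
  | m :: l => (joins l).map (m ||| ·) ∪ joins l

end PointType

/-! ### Relations between the operators -/

section Operators

variable {X : Type*} [TopologicalSpace X] (A : Set X)

theorem interior_frontier_eq_diff :
    interior (frontier A) = interior (closure A) \ closure (interior A) := by
  rw [frontier, Set.sdiff_eq, interior_inter, interior_compl, Set.sdiff_eq]

theorem closure_interior_closure_eq_union :
    closure (interior (closure A)) =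
      closure (interior A) ∪ closure (interior (frontier A)) := by
  apply Set.Subset.antisymm
  · have h : interior (closure A) ⊆ closure (interior A) ∪ interior (frontier A) := by
      intro x hx
      rw [interior_frontier_eq_diff]
      by_cases h : x ∈ closure (interior A)
      · exact Or.inl h
      · exact Or.inr ⟨hx, h⟩
    simpa only [closure_union, closure_closure] using closure_mono h
  · exact Set.union_subset (closure_mono (interior_mono subset_closure))
      (closure_mono (interior_mono (frontier_subset_closure)))

/-- The complement of `ibi` is the closure of the complement of `bi`. At a point of the open set
`ib` this closure may be computed inside `ib`, where the complement of `bi` is `if`. -/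
theorem mem_closure_interior_frontier_iff {x : X} (hx : x ∈ interior (closure A)) :
    x ∈ closure (interior (frontier A)) ↔ x ∉ interior (closure (interior A)) := by
  rw [← Set.mem_compl_iff, ← closure_compl, interior_frontier_eq_diff, Set.sdiff_eq, Set.inter_comm]
  refine ⟨fun h => closure_mono Set.inter_subset_left h, fun h => ?_⟩
  rw [Set.inter_comm]
  exact isOpen_interior.inter_closure ⟨hx, h⟩

end Operators

/-! ### Points have types -/

namespace PointType

variable {X : Type*} [TopologicalSpace X]

/-- The point `x` belongs to the same sets `oA` as points of type `t`. -/
def HasType (A : Set X) (x : X) (t : PointType) : Prop :=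
  ∀ o : KF0, x ∈ o.apply A ↔ t.mem o = true

/-- Seven memberships suffice: the frontier of an open or closed set is a difference of the set and
its closure or interior, and `if` and `bib` are covered by the identities above. -/
theorem hasType_of_base {A : Set X} {x : X} {t : PointType}
    (h_id : x ∈ A ↔ t.inId = true) (h_b : x ∈ closure A ↔ t.inB = true)
    (h_i : x ∈ interior A ↔ t.inI = true) (h_bi : x ∈ closure (interior A) ↔ t.inBi = true)
    (h_ib : x ∈ interior (closure A) ↔ t.inIb = true)
    (h_ibi : x ∈ interior (closure (interior A)) ↔ t.inIbi = true)
    (h_bif : x ∈ closure (interior (frontier A)) ↔ t.inBif = true) : HasType A x t := by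
  have h_and : ∀ p q : Bool, (p && !q) = true ↔ p = true ∧ ¬ q = true := by decide
  have h_f : x ∈ frontier A ↔ (t.inB && !t.inI) = true := by
    rw [frontier, Set.mem_sdiff, h_b, h_i]
    exact (h_and _ _).symm
  have h_if : x ∈ interior (frontier A) ↔ (t.inIb && !t.inBi) = true := by
    simp [interior_frontier_eq_diff, h_ib, h_bi]
  have h_bib : x ∈ closure (interior (closure A)) ↔ (t.inBi || t.inBif) = true := by
    simp [closure_interior_closure_eq_union, h_bi, h_bif]
  intro o
  cases o
  · exact h_id
  · exact h_b
  · exact h_i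
  · exact h_bi
  · exact h_ib
  · exact h_bib
  · exact h_ibi
  · simp [KF0.apply, mem]
  · exact h_f
  · exact h_if
  · rw [KF0.apply, isOpen_interior.frontier_eq, Set.mem_sdiff, h_bif, h_if]
    exact (h_and _ _).symm
  · exact h_bif
  · rw [KF0.apply, isClosed_frontier.frontier_eq, Set.mem_sdiff, h_f, h_if]
    exact (h_and _ _).symm
  · rw [KF0.apply, isClosed_closure.frontier_eq, Set.mem_sdiff, h_b, h_ib]
    exact (h_and _ _).symm
  · rw [KF0.apply, isOpen_interior.frontier_eq, Set.mem_sdiff, h_bi, h_i]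
    exact (h_and _ _).symm
  · rw [KF0.apply, isClosed_closure.frontier_eq, Set.mem_sdiff, h_bi, h_ibi]
    exact (h_and _ _).symm
  · rw [KF0.apply, isOpen_interior.frontier_eq, Set.mem_sdiff, h_bib, h_ib]
    exact (h_and _ _).symm

set_option synthInstance.maxSize 1000 in
set_option synthInstance.maxHeartbeats 200000 in
theorem exists_type_of_base : ∀ a b i bi ib ibi g : Bool, (i → a) → (a → b) → (i → ibi) →
    (ibi → bi) → (ibi → ib) → (bi → b) → (ib → b) → (g → b) → (ib → (g ↔ ¬ ibi)) →
    ∃ t : PointType, t.inId = a ∧ t.inB = b ∧ t.inI = i ∧ t.inBi = bi ∧ t.inIb = ib ∧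
      t.inIbi = ibi ∧ t.inBif = g := by
  decide +kernel

theorem exists_hasType (A : Set X) (x : X) : ∃ t, HasType A x t := by
  have h₁ : x ∈ interior A → x ∈ A := fun h => interior_subset h
  have h₂ : x ∈ A → x ∈ closure A := fun h => subset_closure h
  have h₃ : x ∈ interior A → x ∈ interior (closure (interior A)) :=
    fun h => interior_maximal subset_closure isOpen_interior h
  have h₄ : x ∈ interior (closure (interior A)) → x ∈ closure (interior A) :=
    fun h => interior_subset h
  have h₅ : x ∈ interior (closure (interior A)) → x ∈ interior (closure A) :=
    fun h => interior_mono (closure_mono interior_subset) h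
  have h₆ : x ∈ closure (interior A) → x ∈ closure A := fun h => closure_mono interior_subset h
  have h₇ : x ∈ interior (closure A) → x ∈ closure A := fun h => interior_subset h
  have h₈ : x ∈ closure (interior (frontier A)) → x ∈ closure A := fun h =>
    isClosed_closure.closure_subset_iff.2 (interior_subset.trans frontier_subset_closure) h
  have h₉ : x ∈ interior (closure A) →
      (x ∈ closure (interior (frontier A)) ↔ x ∉ interior (closure (interior A))) :=
    fun h => mem_closure_interior_frontier_iff A h
  classical
  obtain ⟨t, e₁, e₂, e₃, e₄, e₅, e₆, e₇⟩ := exists_type_of_base (decide (x ∈ A))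
    (decide (x ∈ closure A)) (decide (x ∈ interior A)) (decide (x ∈ closure (interior A)))
    (decide (x ∈ interior (closure A))) (decide (x ∈ interior (closure (interior A))))
    (decide (x ∈ closure (interior (frontier A)))) (by simpa using h₁) (by simpa using h₂)
    (by simpa using h₃) (by simpa using h₄) (by simpa using h₅) (by simpa using h₆)
    (by simpa using h₇) (by simpa using h₈) (by simpa using h₉)
  refine ⟨t, hasType_of_base ?_ ?_ ?_ ?_ ?_ ?_ ?_⟩ <;> simp only [*, decide_eq_true_eq]

/-- The set of types of points is an upper set. -/
theorem HasType.exists_of_le {A : Set X} {x : X} {t s : PointType} (h : HasType A x t)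
    (hts : t ≤ s) : ∃ y, HasType A y s := by
  -- Each nontrivial relation `t ≤ s` comes from an operator set containing points of type `t` whose
  -- nonemptiness produces a point of type `s`.
  have hcases : ∀ t s : PointType, t.leB s = true → t = s ∨
      (s = core ∧ t.mem .bi = true) ∨ (s = ext ∧ t.mem .fb = true) ∨
      ((s = scrOut ∨ s = scrIn) ∧ t.mem .bif = true) ∨
      (s = shellOut ∧ t.mem .ibi = true ∧ t.mem .i = false) ∨
      (s = sparseIn ∧ t.mem .b = true ∧ t.mem .bib = false) := by decide +kernel
  -- Every point has some type, so it is enough that the known memberships of `y` exclude all types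
  -- but `s`.
  have of_mem : ∀ y : X, ∀ s : PointType, (∀ u, HasType A y u → u = s) → HasType A y s := by
    intro y s hy
    obtain ⟨u, hu⟩ := exists_hasType A y
    exact hy u hu ▸ hu
  rcases hcases t s hts with rfl | ⟨rfl, h₁⟩ | ⟨rfl, h₁⟩ | ⟨hs, h₁⟩ | ⟨rfl, h₁, h₂⟩ |
    ⟨rfl, h₁, h₂⟩
  · exact ⟨x, h⟩
  · have hx : x ∈ closure (interior A) := (h .bi).2 h₁
    obtain ⟨y, hy⟩ := closure_nonempty_iff.1 ⟨x, hx⟩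
    refine ⟨y, of_mem y _ fun u hu => ?_⟩
    have hd : ∀ u : PointType, u.mem .i = true → u = core := by decide +kernel
    exact hd u ((hu .i).1 hy)
  · have hx : x ∈ frontier (closure A) := (h .fb).2 h₁
    obtain ⟨y, hy⟩ : ∃ y, y ∉ closure A := by
      by_contra! hall
      simp [Set.eq_univ_of_forall hall] at hx
    refine ⟨y, of_mem y _ fun u hu => ?_⟩
    have hd : ∀ u : PointType, ¬ u.mem .b = true → u = ext := by decide +kernel
    exact hd u fun hb => hy ((hu .b).2 hb)
  · have hx : x ∈ closure (interior (frontier A)) := (h .bif).2 h₁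
    obtain ⟨y, hy⟩ := closure_nonempty_iff.1 ⟨x, hx⟩
    rcases hs with rfl | rfl
    -- An open set inside `A` would lie in `interior A`, which is disjoint from the frontier.
    · obtain ⟨z, hz, hzA⟩ : ∃ z ∈ interior (frontier A), z ∉ A := by
        by_contra! hall
        exact (interior_subset hy).2 (interior_maximal hall isOpen_interior hy)
      refine ⟨z, of_mem z _ fun u hu => ?_⟩
      have hd : ∀ u : PointType, u.mem .i_f = true → ¬ u.mem .id = true → u = scrOut := by
        decide +kernel
      exact hd u ((hu .i_f).1 hz) fun hi => hzA ((hu .id).2 hi)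
    · obtain ⟨z, hz, hzA⟩ := mem_closure_iff.1 (interior_subset hy).1 _ isOpen_interior hy
      refine ⟨z, of_mem z _ fun u hu => ?_⟩
      have hd : ∀ u : PointType, u.mem .i_f = true → u.mem .id = true → u = scrIn := by
        decide +kernel
      exact hd u ((hu .i_f).1 hz) ((hu .id).1 hzA)
  · have hx : x ∈ interior (closure (interior A)) := (h .ibi).2 h₁
    have hx' : x ∉ interior A := fun hi => by simpa [h₂] using (h .i).1 hi
    obtain ⟨z, hz, hzA⟩ : ∃ z ∈ interior (closure (interior A)), z ∉ A := by
      by_contra! hall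
      exact hx' (interior_maximal hall isOpen_interior hx)
    refine ⟨z, of_mem z _ fun u hu => ?_⟩
    have hd : ∀ u : PointType, u.mem .ibi = true → ¬ u.mem .id = true → u = shellOut := by
      decide +kernel
    exact hd u ((hu .ibi).1 hz) fun hi => hzA ((hu .id).2 hi)
  · have hx : x ∈ closure A := (h .b).2 h₁
    have hx' : x ∈ (closure (interior (closure A)))ᶜ :=
      fun hi => by simpa [h₂] using (h .bib).1 hi
    obtain ⟨z, hz, hzA⟩ := mem_closure_iff.1 hx _ isClosed_closure.isOpen_compl hx'
    refine ⟨z, of_mem z _ fun u hu => ?_⟩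
    have hd : ∀ u : PointType, ¬ u.mem .bib = true → u.mem .id = true → u = sparseIn := by
      decide +kernel
    exact hd u (fun hi => hz ((hu .bib).2 hi)) ((hu .id).1 hzA)

/-! ### The universal model -/

instance instTopologicalSpace : TopologicalSpace PointType := Topology.upperSet PointType

instance instIsUpperSet : Topology.IsUpperSet PointType := ⟨rfl⟩

/-- The smallest neighbourhood of `t` is `Set.Ici t`, so closures and interiors in the model become
finite checks on Boolean predicates. -/
theorem closure_setOf_eq {p q : PointType → Bool}
    (h : ∀ t, q t = true ↔ ∃ s, t ≤ s ∧ p s = true) :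
    closure {t | p t = true} = {t | q t = true} := by
  ext t
  rw [Topology.IsUpperSet.closure_eq_lowerClosure, SetLike.mem_coe, mem_lowerClosure]
  simp only [Set.mem_ofPred_eq, h, and_comm]

theorem interior_setOf_eq {p q : PointType → Bool}
    (h : ∀ t, q t = true ↔ ∀ s, t ≤ s → p s = true) :
    interior {t | p t = true} = {t | q t = true} := by
  ext t
  rw [mem_interior_iff_mem_nhds, Topology.IsUpperSet.nhds_eq_principal_Ici,
    Filter.mem_principal]
  exact (h t).symm

theorem hasType_self (t : PointType) : HasType {t : PointType | t.inId = true} t t := by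
  have h_b : closure {t : PointType | t.inId = true} = {t | t.inB = true} :=
    closure_setOf_eq (by decide +kernel)
  have h_i : interior {t : PointType | t.inId = true} = {t | t.inI = true} :=
    interior_setOf_eq (by decide +kernel)
  have h_bi : closure {t : PointType | t.inI = true} = {t | t.inBi = true} :=
    closure_setOf_eq (by decide +kernel)
  have h_ib : interior {t : PointType | t.inB = true} = {t | t.inIb = true} :=
    interior_setOf_eq (by decide +kernel)
  have h_ibi : interior {t : PointType | t.inBi = true} = {t | t.inIbi = true} :=
    interior_setOf_eq (by decide +kernel)
  have h_if : interior (frontier {t : PointType | t.inId = true}) =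
      {t | (t.inIb && !t.inBi) = true} := by
    rw [interior_frontier_eq_diff, h_b, h_i, h_bi, h_ib]
    ext t
    simp
  have h_bif : closure {t : PointType | (t.inIb && !t.inBi) = true} = {t | t.inBif = true} :=
    closure_setOf_eq (by decide +kernel)
  apply hasType_of_base <;> simp only [h_b, h_i, h_bi, h_ib, h_ibi, h_if, h_bif, Set.mem_ofPred_eq]

end PointType

/-! ### Local orderings as orderings of upper sets of types -/

theorem KF0.apply_preimage {X Y : Type*} [TopologicalSpace X] [TopologicalSpace Y] {g : X → Y}
    (hg : IsOpenMap g) (hc : Continuous g) (A : Set Y) (o : KF0) :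
    o.apply (g ⁻¹' A) = g ⁻¹' (o.apply A) := by
  cases o <;> simp only [KF0.apply, hg.preimage_closure_eq_closure_preimage hc,
    hg.preimage_interior_eq_interior_preimage hc, hg.preimage_frontier_eq_frontier_preimage hc,
    Set.preimage_empty]

namespace PointType

/-- The pairs `(o₁, o₂)` such that no type in `T` separates `o₁` from `o₂`. -/
def ordering (T : Set PointType) : Set (KF0 × KF0) :=
  {p | ∀ t ∈ T, t.mem p.1 = true → t.mem p.2 = true}

theorem isLocalOrdering_iff {P : Set (KF0 × KF0)} :
    KF0.IsLocalOrdering.{u} P ↔ ∃ T : Set PointType, IsUpperSet T ∧ P = ordering T := by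
  constructor
  · rintro ⟨X, _, A, hA⟩
    refine ⟨{t | ∃ x, HasType A x t}, fun t s hts ⟨x, hx⟩ => hx.exists_of_le hts, ?_⟩
    ext ⟨o₁, o₂⟩
    rw [← hA o₁ o₂]
    constructor
    · rintro h t ⟨x, hx⟩ h₁
      exact (hx o₂).1 (h ((hx o₁).2 h₁))
    · intro h x h₁
      obtain ⟨t, ht⟩ := exists_hasType A x
      exact (ht o₂).2 (h t ⟨x, ht⟩ ((ht o₁).1 h₁))
  · rintro ⟨T, hT, rfl⟩
    -- The witness is `T` as an open subspace of the model, lifted to the required universe; open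
    -- continuous maps pull all operators back.
    have hopen : IsOpen T := Topology.IsUpperSet.isOpen_iff_isUpperSet.2 hT
    let g : ULift.{u} T → PointType := fun x => x.down
    have hg : IsOpenMap g := hopen.isOpenMap_subtype_val.comp Homeomorph.ulift.isOpenMap
    have hc : Continuous g := continuous_subtype_val.comp continuous_uliftDown
    refine ⟨ULift.{u} T, inferInstance, g ⁻¹' {t | t.inId = true}, fun o₁ o₂ => ?_⟩
    rw [KF0.apply_preimage hg hc, KF0.apply_preimage hg hc]
    constructor
    · intro h t ht h₁
      exact (hasType_self t o₂).1 (h (a := ⟨⟨t, ht⟩⟩) ((hasType_self t o₁).2 h₁))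
    · intro h x h₁
      exact (hasType_self _ o₂).2 (h _ x.down.2 ((hasType_self _ o₁).1 h₁))

/-! ### Encoding by numbers -/

/-- The pairs whose bits in `m` vanish. -/
def decode (m : ℕ) : Set (KF0 × KF0) :=
  {p | ∀ k, opPair k = p → m.testBit k = false}

theorem opPair_surjective : Function.Surjective opPair := by
  have h : ∀ o : KF0, ∃ i, ops i = o := by decide +kernel
  rintro ⟨o₁, o₂⟩
  obtain ⟨i, rfl⟩ := h o₁
  obtain ⟨j, rfl⟩ := h o₂
  refine ⟨finProdFinEquiv (i, j), ?_⟩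
  have := finProdFinEquiv.symm_apply_apply (i, j)
  rw [finProdFinEquiv_symm_apply, Prod.mk.injEq] at this
  rw [opPair, this.1, this.2]

theorem opPair_injective : Function.Injective opPair := by
  have h : Function.Injective ops := by
    have : ∀ i j, ops i = ops j → i = j := by decide +kernel
    exact this
  intro k l hkl
  rw [opPair, opPair, Prod.mk.injEq] at hkl
  apply finProdFinEquiv.symm.injective
  simp only [finProdFinEquiv_symm_apply, h hkl.1, h hkl.2]

theorem opPair_mem_decode {m : ℕ} {k : Fin (17 * 17)} :
    opPair k ∈ decode m ↔ m.testBit k = false :=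
  ⟨fun h => h k rfl, fun h l hl => by rwa [opPair_injective hl]⟩

set_option exponentiation.threshold 300 in
-- The bound is needed because `decode` ignores all bits beyond the 289 that number pairs of
-- operators.
theorem decode_injOn : Set.InjOn decode {m | m < 2 ^ (17 * 17)} := by
  intro m hm n hn h
  refine Nat.eq_of_testBit_eq fun k => ?_
  by_cases hk : k < 17 * 17
  · have := @opPair_mem_decode m ⟨k, hk⟩
    rw [h, opPair_mem_decode] at this
    simpa using this.symm
  · have hle : 2 ^ (17 * 17) ≤ 2 ^ k := Nat.pow_le_pow_right two_pos (not_lt.1 hk)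
    rw [Nat.testBit_lt_two_pow (lt_of_lt_of_le hm hle),
      Nat.testBit_lt_two_pow (lt_of_lt_of_le hn hle)]

theorem mem_all (t : PointType) : t ∈ all := by
  cases t <;> decide

theorem violates_eq_true {t : PointType} {p : KF0 × KF0} :
    t.violates p = true ↔ ∃ s, t ≤ s ∧ s.mem p.1 = true ∧ s.mem p.2 = false := by
  simp only [violates, List.any_eq_true, mem_all, true_and, Bool.and_eq_true,
    Bool.not_eq_true', and_assoc]
  rfl

theorem decode_mask (t : PointType) : decode t.mask = ordering (Set.Ici t) := by
  ext p
  obtain ⟨k, rfl⟩ := opPair_surjective p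
  rw [opPair_mem_decode, mask, Nat.testBit_ofBits_lt _ _ k.2, ← Bool.not_eq_true,
    violates_eq_true]
  simp only [ordering, Set.mem_ofPred_eq, Set.mem_Ici]
  push Not
  simp only [ne_eq, Bool.not_eq_false]

theorem decode_zero : decode 0 = Set.univ := by
  ext p
  simp [decode]

theorem decode_or (m n : ℕ) : decode (m ||| n) = decode m ∩ decode n := by
  ext p
  obtain ⟨k, rfl⟩ := opPair_surjective p
  rw [Set.mem_inter_iff, opPair_mem_decode, opPair_mem_decode, opPair_mem_decode,
    Nat.testBit_or, Bool.or_eq_false_iff]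

theorem ordering_union (S T : Set PointType) :
    ordering (S ∪ T) = ordering S ∩ ordering T := by
  ext p
  simp only [ordering, Set.mem_union, Set.mem_inter_iff, Set.mem_ofPred_eq, or_imp, forall_and]

set_option exponentiation.threshold 300 in
theorem mask_lt (t : PointType) : t.mask < 2 ^ (17 * 17) := Nat.ofBits_lt_two_pow _

set_option exponentiation.threshold 300 in
theorem joins_lt (l : List PointType) : ∀ m ∈ joins (l.map mask), m < 2 ^ (17 * 17) := by
  induction l with
  | nil => simp [joins]
  | cons t l ih =>
    intro m hm
    rw [List.map_cons, joins, List.mem_union_iff, List.mem_map] at hm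
    rcases hm with ⟨n, hn, rfl⟩ | hm
    · exact Nat.or_lt_two_pow t.mask_lt (ih n hn)
    · exact ih m hm

/-- The list union drops repeated values, whatever its first argument, so the length of `joins`
counts distinct numbers. -/
theorem nodup_joins (l : List ℕ) : (joins l).Nodup := by
  cases l with
  | nil => simp [joins]
  | cons m l => exact List.Nodup.union _ (nodup_joins l)

/-- A bitwise union of masks encodes the upper set generated by the chosen types; `S` is the set of
generators and need not be upper. The induction decides for each listed type whether it is a
generator. -/
theorem exists_mem_joins_iff (l : List PointType) (P : Set (KF0 × KF0)) :
    (∃ m ∈ joins (l.map mask), decode m = P) ↔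
      ∃ S : Set PointType, (∀ t ∈ S, t ∈ l) ∧ ordering (upperClosure S : Set PointType) = P := by
  induction l generalizing P with
  | nil =>
    constructor
    · rintro ⟨m, hm, rfl⟩
      rw [List.map_nil, joins, List.mem_singleton] at hm
      exact ⟨∅, by simp, by simp [hm, decode_zero, ordering]⟩
    · rintro ⟨S, hS, rfl⟩
      have : S = ∅ := Set.eq_empty_of_forall_notMem fun t ht => by simpa using hS t ht
      exact ⟨0, by simp [joins], by simp [this, decode_zero, ordering]⟩
  | cons t l ih =>
    constructor
    · rintro ⟨m, hm, rfl⟩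
      rw [List.map_cons, joins, List.mem_union_iff, List.mem_map] at hm
      rcases hm with ⟨n, hn, rfl⟩ | hm
      · obtain ⟨S, hS, hSn⟩ := (ih _).1 ⟨n, hn, rfl⟩
        refine ⟨{t} ∪ S, ?_, ?_⟩
        · rintro s (rfl | hs)
          · simp
          · exact List.mem_cons_of_mem _ (hS s hs)
        · rw [upperClosure_union, UpperSet.coe_inf, ordering_union, hSn, decode_or, decode_mask,
            upperClosure_singleton, UpperSet.coe_Ici]
      · obtain ⟨S, hS, hSn⟩ := (ih _).1 ⟨m, hm, rfl⟩
        exact ⟨S, fun s hs => List.mem_cons_of_mem _ (hS s hs), hSn⟩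
    · rintro ⟨S, hS, rfl⟩
      by_cases ht : t ∈ S
      · obtain ⟨n, hn, hSn⟩ := (ih _).2 ⟨S \ {t}, fun s hs =>
          (List.mem_cons.1 (hS s hs.1)).resolve_left hs.2, rfl⟩
        refine ⟨t.mask ||| n, ?_, ?_⟩
        · rw [List.map_cons, joins, List.mem_union_iff, List.mem_map]
          exact Or.inl ⟨n, hn, rfl⟩
        · conv_rhs => rw [← Set.insert_sdiff_self_of_mem ht, Set.insert_eq]
          rw [upperClosure_union, UpperSet.coe_inf, ordering_union, ← hSn, decode_or, decode_mask,
            upperClosure_singleton, UpperSet.coe_Ici]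
      · obtain ⟨n, hn, hSn⟩ := (ih _).2 ⟨S, fun s hs =>
          (List.mem_cons.1 (hS s hs)).resolve_left (fun h => ht (h ▸ hs)), rfl⟩
        refine ⟨n, ?_, hSn⟩
        rw [List.map_cons, joins, List.mem_union_iff]
        exact Or.inr hn

/-! ### The final count -/

theorem setOf_isLocalOrdering_eq :
    {P : Set (KF0 × KF0) | KF0.IsLocalOrdering.{u} P} =
      decode '' ((joins (all.map mask)).toFinset : Set ℕ) := by
  ext P
  simp only [Set.mem_ofPred_eq, isLocalOrdering_iff, Set.mem_image, List.coe_toFinset]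
  rw [exists_mem_joins_iff]
  constructor
  · rintro ⟨T, hT, rfl⟩
    exact ⟨T, fun t _ => mem_all t, by rw [hT.upperClosure]⟩
  · rintro ⟨S, -, rfl⟩
    exact ⟨_, UpperSet.upper _, rfl⟩

/-- Evaluating the masks first lets the count work on numerals. The equal entries belong to `scrOut`
and `scrIn`, which force each other; the entry 0 belongs to `ext`, which lies in none of the
seventeen sets and separates nothing. -/
theorem map_mask_all : all.map mask =
    [663970026474429980932151702898999168,
      48682378890438705431841649386167320791924826631619965218712955153371389230976,
      48682378890438705431841649386167320791924826631619965218712955153371389230980,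
      25148619626002897470764039292559091258060748782887713160033484,
      25148619626002897470764039292559091258060748782887713160033484,
      4309640752977794960396366376282734446345853386316690700698328434247839958794239948,
      4309582856491464536078347499684765305120898884301787731288347244210530291803750348,
      5501740986138738783753138001560857434441212381141667931231948528881073192786015813580,
      5494152377881995695775547501216900120237538639047151774053005602647921728116991197148,
      28813945550853505050911129806000239525911377369326646215431311350359798945267841761152,
      28806356942596761962933539305656283708285380166964432367065351793350332437607488290772,
      378554834721408350546280356920893145532760621020449259594337667392890079102631914763468,
      378547246171048093788727058728417076547276086934618692640953225391125252295269591807708,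
      399431507237810830457022043500520821541747974732057767391367335945948924,
      399428137218766427918903865714876438324523408202003078019779979967581948,
      0] := by
  decide +kernel

theorem length_joins_all : (joins (all.map mask)).length = 274 := by
  rw [map_mask_all]
  decide +kernel

end PointType

theorem mainTheorem6 :
    {P : Set (KF0 × KF0) | KF0.IsLocalOrdering.{u} P}.ncard = 274 := by
  rw [PointType.setOf_isLocalOrdering_eq, Set.InjOn.ncard_image, Set.ncard_coe_finset,
    List.toFinset_card_of_nodup (PointType.nodup_joins _), PointType.length_joins_all]
  refine PointType.decode_injOn.mono fun m hm => ?_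
  exact PointType.joins_lt _ m (by simpa using hm)
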